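/- Work over $\mathbb{Q}$ with variables $x_1,x_2,\dots$. A linear clause is a finite disjunction of distinct linear equations $\bigvee_j (f_j=0)$, where each $f_j=\sum_i a_{ji}x_i+b_j$ is a linear polynomial with rational coefficients; repeated disjuncts are contracted, and $f=A$ abbreviates $f-A=0$. The system $\mathrm{Res}(\mathrm{lin}_{\mathbb{Q}})$ has the boolean axioms $x_i=0\vee x_i=1$ and the rules - Resolution: from $C\vee f=0$ and $D\vee g=0$ derive $C\vee D\vee(\alpha f+\beta g=0)$, for any $\alpha,\beta\in\mathbb{Q}$; - Simplification: from $C\vee a=0$ with $0\neq a\in\mathbb{Q}$ derive $C$; - Weakening: from $C$ derive $C\vee f=0$. A derivation of a linear clause $E$ is a finite sequence of linear clauses ending in $E$, each of which is a boolean axiom or follows by a rule from earlier clauses of the sequence; it is tree-like if every clause of the sequence is used at most once as a premise of a rule. The size of a linear clause is the number of occurrences of variables in it plus the total size of the binary representations of the coefficients (including constant terms) occurring in it, and the size of a derivation is the sum of the sizes of its clauses. For a linear polynomial $f$ let $im_2(f)\subset\mathbb{Q}$ be the (finite) set of values of $f$ under 0-1 assignments to its variables, and let $\mathrm{Im}(f):=\bigvee_{A\in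 im_2(f)}(f=A)$. Theorem. There is an absolute constant $c>0$ such that for every $n\ge 0$ and every linear polynomial $f$ over $\mathbb{Q}$ that depends on exactly $n$ variables (i.e. has exactly $n$ nonzero variable coefficients), every tree-like $\mathrm{Res}(\mathrm{lin}_{\mathbb{Q}})$ derivation of $\mathrm{Im}(f)$ (from no clauses other than the boolean axioms) has size at least $2^{c\sqrt{n}}$. -/

import Mathlib

namespace ResLin

/-- A linear polynomial `∑ aᵢ xᵢ + a₀` over `R` in the variables `x₀, x₁, x₂, …`, given by its
finitely supported family of variable coefficients and its constant term. -/
abbrev LinPoly (R : Type) [Ring R] : Type := (ℕ →₀ R) × R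

section General

variable {R : Type} [Ring R]

/-- The variable `xᵢ`. -/
noncomputable def LinPoly.var (R : Type) [Ring R] (i : ℕ) : LinPoly R := (Finsupp.single i 1, 0)

/-- The constant polynomial `a`. -/
def LinPoly.const (a : R) : LinPoly R := (0, a)

/-- The set of variables on which `f` depends, i.e. those with nonzero coefficient. -/
def LinPoly.vars (f : LinPoly R) : Finset ℕ := f.1.support

/-- The value of `f` at an assignment. -/
def LinPoly.eval (ρ : ℕ → R) (f : LinPoly R) : R := (∑ i ∈ f.vars, f.1 i * ρ i) + f.2

/-- The image of `f` under 0-1 assignments. -/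
def im₂ (f : LinPoly R) : Set R := {A | ∃ ρ : ℕ → R, (∀ i, ρ i = 0 ∨ ρ i = 1) ∧ f.eval ρ = A}

theorem im₂_finite (f : LinPoly R) : (im₂ f).Finite := by
  classical
  refine ((f.vars.powerset.image fun S => (∑ i ∈ S, f.1 i) + f.2).finite_toSet).subset ?_
  rintro A ⟨ρ, hρ, rfl⟩
  simp only [Finset.coe_image, Set.mem_image, Finset.mem_coe, Finset.mem_powerset]
  refine ⟨f.vars.filter fun i => ρ i = 1, Finset.filter_subset _ _, ?_⟩
  rw [LinPoly.eval, Finset.sum_filter]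
  congr 1
  refine Finset.sum_congr rfl fun i _ => ?_
  by_cases h : ρ i = 1
  · simp [h]
  · rw [if_neg h, (hρ i).resolve_right h, mul_zero]

variable [DecidableEq R]

/-- A linear clause: the disjunction of the equations `f = 0`, for `f` in a finite set of linear
polynomials (so duplicate disjuncts are contracted). The empty clause is falsity. -/
abbrev LinClause (R : Type) [Ring R] : Type := Finset (LinPoly R)

/-- The boolean axiom `xᵢ = 0 ∨ xᵢ = 1`. -/
noncomputable def booleanAxiom (R : Type) [Ring R] [DecidableEq R] (i : ℕ) : LinClause R :=
  {LinPoly.var R i, LinPoly.var R i - LinPoly.const 1}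

/-- The image axiom of `f`: the disjunction of `f = A`, i.e. `f - A = 0`, over `A ∈ im₂ f`. -/
noncomputable def imageAxiom (f : LinPoly R) : LinClause R :=
  (im₂_finite f).toFinset.image fun A => f - LinPoly.const A

/-- `Infer φ Ps E`: the clause `E` is an element of `φ`, a boolean axiom, or the conclusion of one
application of a rule of Res(lin_R); `Ps` is the list of premises of that application. -/
inductive Infer (φ : Set (LinClause R)) : List (LinClause R) → LinClause R → Prop
  | hyp (C : LinClause R) (hC : C ∈ φ) : Infer φ [] C
  | boolean (i : ℕ) : Infer φ [] (booleanAxiom R i)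
  | resolution (C D : LinClause R) (f g : LinPoly R) (α β : R) :
      Infer φ [insert f C, insert g D] (insert (α • f + β • g) (C ∪ D))
  | simplification (C : LinClause R) (a : R) (ha : a ≠ 0) :
      Infer φ [insert (LinPoly.const a) C] C
  | weakening (C : LinClause R) (f : LinPoly R) : Infer φ [C] (insert f C)

/-- A Res(lin_R) derivation of the clause `E` from the set of clauses `φ`: a nonempty sequence of
clauses ending in `E`, each of which is inferred from earlier ones; `premises i` records the
positions of the premises used for the `i`-th clause. -/
structure Derivation (φ : Set (LinClause R)) (E : LinClause R) where
  length_pred : ℕ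
  clause : Fin (length_pred + 1) → LinClause R
  premises : Fin (length_pred + 1) → List (Fin (length_pred + 1))
  premises_lt : ∀ i, ∀ j ∈ premises i, j < i
  infer : ∀ i, Infer φ ((premises i).map clause) (clause i)
  clause_last : clause (Fin.last length_pred) = E

/-- A derivation is tree-like if every clause in it (every position of the sequence) is used at
most once as a premise. -/
def Derivation.TreeLike {φ : Set (LinClause R)} {E : LinClause R} (π : Derivation φ E) : Prop :=
  ∀ j, ∑ i, (π.premises i).count j ≤ 1

end General

/-- Size of the binary representation of a rational number in lowest terms: a sign bit, the bits
of the numerator and the bits of the denominator. -/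
def coeffSize (q : ℚ) : ℕ := 1 + q.num.natAbs.size + q.den.size

/-- The number of occurrences of variables in `f` plus the total size of its coefficients,
including the constant term. -/
def polySize (f : LinPoly ℚ) : ℕ := f.vars.card + ∑ i ∈ f.vars, coeffSize (f.1 i) + coeffSize f.2

/-- The size of a linear clause over `ℚ`. -/
def clauseSize (C : LinClause ℚ) : ℕ := ∑ f ∈ C, polySize f

/-- The size of a derivation: the total size of all its clauses. -/
def Derivation.size {φ : Set (LinClause ℚ)} {E : LinClause ℚ} (π : Derivation φ E) : ℕ :=
  ∑ i, clauseSize (π.clause i)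

end ResLin

/-! Walk from the root of the derivation tree towards its leaves, keeping a satisfiable list `Ψ` of
disequalities such that every disjunct of the current clause is `Tame`: refuted by `Ψ`, or equal to
a nonzero multiple of some `f - A` on its solutions. At a resolution on `g` and `h`, either one of
them vanishes on all solutions and the other premise inherits the invariant for free, or both
branches are open, each at the cost of one disequality. A boolean axiom can satisfy the invariant
only if `f` takes at most two values on the solutions. The algebraic core is that this needs about
`n / 2` disequalities. The product `P` of the polynomials in `Ψ` has degree at most `d = Ψ.length`,
and if `f` is constant on the solutions, `P` is supported on a hyperplane with `n` nonzero
coefficients. Comparing one coefficient of a power of a linear form times `P` gives `n ≤ 2 * d`. So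
the tree branches fully to depth about `n / 2`, and the bound obtained is `2 ^ (n / 2)`. -/

namespace ResLin

/-! ### Multilinear coefficients on the cube -/

section AlternatingSums

variable {ι : Type*}

/-- Up to sign, the coefficient of the monomial `∏ i ∈ T, xᵢ` in the multilinear polynomial
that represents the function `F` on the cube, whose points are given as finite sets. -/
def altSum (T : Finset ι) (F : Finset ι → ℚ) : ℚ := ∑ S ∈ T.powerset, (-1) ^ S.card * F S

theorem altSum_congr {T : Finset ι} {F G : Finset ι → ℚ} (h : ∀ S ⊆ T, F S = G S) :
    altSum T F = altSum T G :=
  Finset.sum_congr rfl fun S hS => by rw [h S (Finset.mem_powerset.1 hS)]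

/-- At a minimum-size point `S` of the support, all other terms of `altSum S F` vanish. -/
theorem exists_altSum_ne_zero {V : Finset ι} {F : Finset ι → ℚ} (hF : ∃ S ⊆ V, F S ≠ 0) :
    ∃ T ⊆ V, altSum T F ≠ 0 := by
  obtain ⟨S, hS, hmin⟩ := Finset.exists_min_image (V.powerset.filter fun S => F S ≠ 0) Finset.card
    (by obtain ⟨S, hS, h⟩ := hF; exact ⟨S, by simp [hS, h]⟩)
  rw [Finset.mem_filter, Finset.mem_powerset] at hS
  refine ⟨S, hS.1, ?_⟩
  have : altSum S F = (-1) ^ S.card * F S := by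
    refine Finset.sum_eq_single_of_mem S (Finset.mem_powerset_self S) fun R hR hne => ?_
    have hR' := Finset.mem_powerset.1 hR
    by_contra h
    have h0 : F R ≠ 0 := right_ne_zero_of_mul h
    have := hmin R (by simp [h0, hR'.trans hS.1])
    exact hne (Finset.eq_of_subset_of_card_le hR' this)
  rw [this]
  exact mul_ne_zero (pow_ne_zero _ (by norm_num)) hS.2

variable [DecidableEq ι]

/-- The linear form with coefficients `b` on `W`, as a function on the cube. -/
def linForm (W : Finset ι) (b : ι → ℚ) (S : Finset ι) : ℚ := ∑ i ∈ W, b i * if i ∈ S then 1 else 0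

/-- This encodes `xᵢ ^ 2 = xᵢ`; the minus sign comes from the sign convention. For `i ∉ T` both
sides are zero. -/
theorem altSum_indicator_mul (T : Finset ι) (F : Finset ι → ℚ) (i : ι) :
    altSum T (fun S => (if i ∈ S then 1 else 0) * F S) = altSum T F - altSum (T.erase i) F := by
  have h : (T.erase i).powerset = T.powerset.filter fun S => i ∉ S := by
    ext S
    simp [Finset.subset_erase]
  rw [altSum, altSum, altSum, h, Finset.sum_filter, ← Finset.sum_sub_distrib]
  refine Finset.sum_congr rfl fun S _ => ?_
  by_cases hi : i ∈ S <;> simp [hi]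

theorem altSum_linForm_mul (T W : Finset ι) (b : ι → ℚ) (F : Finset ι → ℚ) :
    altSum T (fun S => linForm W b S * F S) =
      ∑ i ∈ W, b i * (altSum T F - altSum (T.erase i) F) := by
  simp_rw [← altSum_indicator_mul, altSum, linForm, Finset.sum_mul, Finset.mul_sum]
  rw [Finset.sum_comm]
  exact Finset.sum_congr rfl fun i _ => Finset.sum_congr rfl fun S _ => by ring

theorem altSum_affine_mul (T W : Finset ι) (b : ι → ℚ) (c : ℚ) (F : Finset ι → ℚ) :
    altSum T (fun S => (linForm W b S + c) * F S) =
      ∑ i ∈ W, b i * (altSum T F - altSum (T.erase i) F) + c * altSum T F := by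
  rw [← altSum_linForm_mul]
  simp_rw [altSum, Finset.mul_sum]
  rw [← Finset.sum_add_distrib]
  exact Finset.sum_congr rfl fun S _ => by ring

theorem altSum_affine_mul_eq_zero {d : ℕ} {F : Finset ι → ℚ}
    (hF : ∀ T : Finset ι, d < T.card → altSum T F = 0) (W : Finset ι) (b : ι → ℚ) (c : ℚ)
    (T : Finset ι) (hT : d + 1 < T.card) :
    altSum T (fun S => (linForm W b S + c) * F S) = 0 := by
  rw [altSum_affine_mul, hF T (by omega), mul_zero, add_zero]
  refine Finset.sum_eq_zero fun i _ => ?_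
  have := Finset.pred_card_le_card_erase (s := T) (a := i)
  rw [hF _ (by omega), sub_zero, mul_zero]

/-- Multiplying by variables outside `E` cannot create a monomial divisible by `∏ i ∈ E, xᵢ`. -/
theorem altSum_affine_pow_mul_eq_zero {E W : Finset ι} (hEW : Disjoint E W) {P : Finset ι → ℚ}
    (hP : ∀ T, E ⊆ T → altSum T P = 0) (b : ι → ℚ) (c : ℚ) (j : ℕ) :
    ∀ T, E ⊆ T → altSum T (fun S => (linForm W b S + c) ^ j * P S) = 0 := by
  induction j with
  | zero => simpa using hP
  | succ j ih =>
    intro T hT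
    simp_rw [pow_succ', mul_assoc]
    rw [altSum_affine_mul, ih T hT, mul_zero, add_zero]
    refine Finset.sum_eq_zero fun i hi => ?_
    have : E ⊆ T.erase i := Finset.subset_erase.2 ⟨hT, Finset.disjoint_right.1 hEW hi⟩
    rw [ih _ this, sub_zero, mul_zero]

/-- `P` has degree at most `D.card` and each factor adds at most one variable, so `D ∪ R` needs at
least `R.card` factors. With exactly that many, each factor supplies one variable of `R`, in any of
`j!` orders. -/
theorem altSum_linForm_pow_mul {D E : Finset ι} (hDE : Disjoint D E) {P : Finset ι → ℚ}
    (hP : ∀ T, D.card < T.card → altSum T P = 0) (a : ι → ℚ) (j : ℕ) :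
    ∀ R ⊆ E, (j < R.card → altSum (D ∪ R) (fun S => linForm E a S ^ j * P S) = 0) ∧
      (j = R.card → altSum (D ∪ R) (fun S => linForm E a S ^ j * P S) =
        (-1) ^ j * (j.factorial : ℚ) * (∏ i ∈ R, a i) * altSum D P) := by
  induction j with
  | zero =>
    intro R hR
    refine ⟨fun h => ?_, fun h => ?_⟩
    · simp only [pow_zero, one_mul]
      apply hP
      rw [Finset.card_union_of_disjoint (hDE.mono_right hR)]
      omega
    · simp [Finset.card_eq_zero.1 h.symm]
  | succ j ih =>
    intro R hR
    have key : j < R.card → altSum (D ∪ R) (fun S => linForm E a S ^ (j + 1) * P S) =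
        ∑ i ∈ R, a i * -altSum (D ∪ R.erase i) (fun S => linForm E a S ^ j * P S) := by
      intro h
      simp_rw [pow_succ', mul_assoc]
      rw [altSum_linForm_mul, ← Finset.sum_subset hR]
      · refine Finset.sum_congr rfl fun i hi => ?_
        have hD : i ∉ D := Finset.disjoint_right.1 hDE (hR hi)
        rw [Finset.erase_union_distrib, Finset.erase_eq_of_notMem hD, (ih R hR).1 h, zero_sub]
      · intro i hi hiR
        have hD : i ∉ D := Finset.disjoint_right.1 hDE hi
        rw [Finset.erase_eq_of_notMem (by simp [hD, hiR]), sub_self, mul_zero]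
    refine ⟨fun h => ?_, fun h => ?_⟩
    · rw [key (by omega)]
      refine Finset.sum_eq_zero fun i hi => ?_
      have hc := Finset.card_erase_of_mem hi
      rw [(ih _ ((Finset.erase_subset i R).trans hR)).1 (by omega), neg_zero, mul_zero]
    · rw [key (by omega)]
      have : ∀ i ∈ R, a i * -altSum (D ∪ R.erase i) (fun S => linForm E a S ^ j * P S) =
          (-1) ^ (j + 1) * (j.factorial : ℚ) * (∏ i ∈ R, a i) * altSum D P := by
        intro i hi
        have hc := Finset.card_erase_of_mem hi
        rw [(ih _ ((Finset.erase_subset i R).trans hR)).2 (by omega),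
          ← Finset.mul_prod_erase R a hi]
        ring
      rw [Finset.sum_congr rfl this, Finset.sum_const, ← h, Nat.factorial_succ, nsmul_eq_mul]
      push_cast
      ring

/-- A nonzero function of degree at most `d` on the cube that is supported on a hyperplane
depending on all the coordinates in `V` forces `V` to have at most `2 * d` elements. -/
theorem card_le_two_mul_of_support_subset_hyperplane {V : Finset ι} {a : ι → ℚ}
    (ha : ∀ i ∈ V, a i ≠ 0) {A : ℚ} {P : Finset ι → ℚ} {d : ℕ}
    (hd : ∀ T : Finset ι, d < T.card → altSum T P = 0)
    (hV : ∀ T : Finset ι, ¬ T ⊆ V → altSum T P = 0)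
    (hP : ∃ S ⊆ V, P S ≠ 0) (hA : ∀ S ⊆ V, P S ≠ 0 → linForm V a S = A) :
    V.card ≤ 2 * d := by
  by_contra! hlt
  -- `D` is a monomial of top degree in `P`. As `V` has more than `2 * d` elements, there is room
  -- for `E` disjoint from `D` and one larger, hence too large to divide any monomial of `P`.
  obtain ⟨D, hD, hmax⟩ := Finset.exists_max_image (V.powerset.filter fun T => altSum T P ≠ 0)
    Finset.card (by obtain ⟨T, hT, h⟩ := exists_altSum_ne_zero hP; exact ⟨T, by simp [hT, h]⟩)
  rw [Finset.mem_filter, Finset.mem_powerset] at hD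
  have hDd : D.card ≤ d := by
    by_contra! h
    exact hD.2 (hd D h)
  have htop : ∀ T, D.card < T.card → altSum T P = 0 := by
    intro T hT
    by_contra h
    have hTV : T ⊆ V := by
      by_contra h'
      exact h (hV T h')
    have := hmax T (by simp [h, hTV])
    omega
  have hcard : D.card + 1 ≤ (V \ D).card := by
    rw [Finset.card_sdiff_of_subset hD.1]
    omega
  obtain ⟨E, hE, hEc⟩ := Finset.exists_subset_card_eq hcard
  have hEV : E ⊆ V := hE.trans Finset.sdiff_subset
  have hDE : Disjoint D E := (Finset.sdiff_disjoint.mono_left hE).symm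
  have h1 := (altSum_linForm_pow_mul hDE htop a (D.card + 1) E subset_rfl).2 hEc.symm
  have h2 := altSum_affine_pow_mul_eq_zero (E := E) (W := V \ E) Finset.disjoint_sdiff
    (fun T hT => htop T (by have := Finset.card_le_card hT; omega)) (fun i => -a i) A
    (D.card + 1) (D ∪ E) Finset.subset_union_right
  -- On the support of `P` the hyperplane equation trades the form on `E` for an affine form free of
  -- `E`, so the coefficient at `D ∪ E` is both nonzero by `h1` and zero by `h2`.
  have h3 : altSum (D ∪ E) (fun S => linForm E a S ^ (D.card + 1) * P S) =
      altSum (D ∪ E) (fun S => (linForm (V \ E) (fun i => -a i) S + A) ^ (D.card + 1) * P S) := by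
    refine altSum_congr fun S hS => ?_
    by_cases h0 : P S = 0
    · simp [h0]
    · have hsum := hA S (hS.trans (Finset.union_subset hD.1 hEV)) h0
      have : linForm E a S = linForm (V \ E) (fun i => -a i) S + A := by
        rw [← hsum, linForm, linForm, linForm, ← Finset.sum_sdiff hEV]
        simp [Finset.sum_neg_distrib]
      rw [this]
  rw [h3, h2] at h1
  refine absurd h1.symm (mul_ne_zero (mul_ne_zero (mul_ne_zero (pow_ne_zero _ (by norm_num)) ?_)
    (Finset.prod_ne_zero_iff.2 fun i hi => ha i (hEV hi))) hD.2)
  exact_mod_cast Nat.factorial_ne_zero _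

/-- Toggling an element of `T` outside `V` pairs the terms with opposite signs. -/
theorem altSum_eq_zero_of_not_subset {V T : Finset ι} {F : Finset ι → ℚ}
    (hF : ∀ S, F S = F (S ∩ V)) (hT : ¬ T ⊆ V) : altSum T F = 0 := by
  obtain ⟨i, hiT, hiV⟩ := Finset.not_subset.1 hT
  rw [altSum, ← Finset.insert_erase hiT, Finset.sum_powerset_insert (Finset.notMem_erase i T),
    ← Finset.sum_add_distrib]
  refine Finset.sum_eq_zero fun S hS => ?_
  have hi : i ∉ S := fun h => Finset.notMem_erase i T (Finset.mem_powerset.1 hS h)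
  rw [hF (insert i S), Finset.insert_inter_of_notMem hiV, ← hF S, Finset.card_insert_of_notMem hi]
  ring

end AlternatingSums

/-! ### Linear polynomials on solution sets of disequalities -/

section Solutions

/-- The 0-1 assignments at which none of the polynomials in `Ψ` vanishes. -/
def sols (Ψ : List (LinPoly ℚ)) : Set (ℕ → ℚ) :=
  {ρ | (∀ i, ρ i = 0 ∨ ρ i = 1) ∧ ∀ g ∈ Ψ, g.eval ρ ≠ 0}

theorem LinPoly.eval_eq_sum {W : Finset ℕ} (f : LinPoly ℚ) (h : f.vars ⊆ W) (ρ : ℕ → ℚ) :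
    f.eval ρ = (∑ i ∈ W, f.1 i * ρ i) + f.2 := by
  rw [LinPoly.eval, Finset.sum_subset h]
  intro i _ hi
  rw [Finsupp.notMem_support_iff.1 hi, zero_mul]

theorem LinPoly.eval_add (f g : LinPoly ℚ) (ρ : ℕ → ℚ) :
    (f + g).eval ρ = f.eval ρ + g.eval ρ := by
  classical
  rw [eval_eq_sum f (Finset.subset_union_left (s₂ := g.vars)) ρ,
    eval_eq_sum g (Finset.subset_union_right (s₁ := f.vars)) ρ,
    eval_eq_sum (f + g) (W := f.vars ∪ g.vars) Finsupp.support_add ρ]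
  simp only [Prod.fst_add, Prod.snd_add, Finsupp.add_apply, add_mul, Finset.sum_add_distrib]
  ring

theorem LinPoly.eval_smul (c : ℚ) (f : LinPoly ℚ) (ρ : ℕ → ℚ) :
    (c • f).eval ρ = c * f.eval ρ := by
  rw [eval_eq_sum (c • f) (W := f.vars) Finsupp.support_smul ρ, LinPoly.eval, mul_add,
    Finset.mul_sum]
  simp [mul_assoc]

theorem LinPoly.eval_const (a : ℚ) (ρ : ℕ → ℚ) : (LinPoly.const a).eval ρ = a := by
  simp [LinPoly.eval, LinPoly.const, LinPoly.vars]

theorem LinPoly.eval_sub_const (f : LinPoly ℚ) (a : ℚ) (ρ : ℕ → ℚ) :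
    (f - LinPoly.const a).eval ρ = f.eval ρ - a := by
  have := LinPoly.eval_add (f - LinPoly.const a) (LinPoly.const a) ρ
  rw [sub_add_cancel, LinPoly.eval_const] at this
  linarith

theorem LinPoly.eval_var (i : ℕ) (ρ : ℕ → ℚ) : (LinPoly.var ℚ i).eval ρ = ρ i := by
  rw [LinPoly.eval_eq_sum (W := {i}) _ Finsupp.support_single_subset]
  simp [LinPoly.var]

/-- The assignment that is the indicator of `S` on `V` and `u` elsewhere. -/
def patch (V : Finset ℕ) (u : ℕ → ℚ) (S : Finset ℕ) (i : ℕ) : ℚ :=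
  if i ∈ V then (if i ∈ S then 1 else 0) else u i

theorem exists_affine_eval_patch (V : Finset ℕ) (u : ℕ → ℚ) (g : LinPoly ℚ) :
    ∃ c : ℚ, ∀ S, g.eval (patch V u S) = linForm V g.1 S + c := by
  refine ⟨(∑ i ∈ g.vars \ V, g.1 i * u i) + g.2, fun S => ?_⟩
  rw [LinPoly.eval_eq_sum g (W := g.vars ∪ V) Finset.subset_union_left,
    ← Finset.sum_sdiff (Finset.subset_union_right (s₁ := g.vars)), Finset.union_sdiff_right,
    linForm, ← add_assoc, add_comm (∑ i ∈ V, _)]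
  congr 2
  · refine Finset.sum_congr rfl fun i hi => ?_
    rw [patch, if_neg (Finset.mem_sdiff.1 hi).2]
  · refine Finset.sum_congr rfl fun i hi => ?_
    rw [patch, if_pos hi]

theorem patch_inter (V : Finset ℕ) (u : ℕ → ℚ) (S : Finset ℕ) :
    patch V u S = patch V u (S ∩ V) := by
  funext i
  by_cases hi : i ∈ V <;> simp [patch, hi]

theorem patch_filter {V : Finset ℕ} {u : ℕ → ℚ} (hu : ∀ i, u i = 0 ∨ u i = 1) :
    patch V u (V.filter fun i => u i = 1) = u := by
  funext i
  by_cases hi : i ∈ V <;> rcases hu i with h | h <;> simp [patch, hi, h]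

theorem patch_zero_or_one {V : Finset ℕ} {u : ℕ → ℚ} (hu : ∀ i, u i = 0 ∨ u i = 1)
    (S : Finset ℕ) (i : ℕ) : patch V u S i = 0 ∨ patch V u S i = 1 := by
  by_cases hi : i ∈ V <;> by_cases hS : i ∈ S <;> simp [patch, hi, hS, hu]

theorem altSum_prod_eval_patch_eq_zero (V : Finset ℕ) (u : ℕ → ℚ) (Ψ : List (LinPoly ℚ))
    (T : Finset ℕ) (hT : Ψ.length < T.card) :
    altSum T (fun S => (Ψ.map fun g => g.eval (patch V u S)).prod) = 0 := by
  induction Ψ generalizing T with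
  | nil =>
    simp only [List.map_nil, List.prod_nil, altSum, mul_one]
    rw [List.length_nil, Finset.card_pos] at hT
    have := Finset.sum_powerset_neg_one_pow_card_of_nonempty hT
    exact_mod_cast this
  | cons g Ψ ih =>
    obtain ⟨c, hc⟩ := exists_affine_eval_patch V u g
    simp only [List.map_cons, List.prod_cons, hc]
    exact altSum_affine_mul_eq_zero ih V g.1 c T hT

/-- If `f` is constant on a nonempty solution set of disequalities, then it depends on at most
twice as many variables as there are disequalities. -/
theorem card_vars_le_of_const (f : LinPoly ℚ) (Ψ : List (LinPoly ℚ)) (hne : (sols Ψ).Nonempty)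
    (A : ℚ) (h : ∀ ρ ∈ sols Ψ, f.eval ρ = A) : f.vars.card ≤ 2 * Ψ.length := by
  obtain ⟨u, hu, huΨ⟩ := hne
  obtain ⟨c, hc⟩ := exists_affine_eval_patch f.vars u f
  -- Variables outside `f.vars` are frozen at the solution `u`; the product is then nonzero exactly
  -- where the patched point solves `Ψ`.
  refine card_le_two_mul_of_support_subset_hyperplane (V := f.vars) (a := f.1) (A := A - c)
    (P := fun S => (Ψ.map fun g => g.eval (patch f.vars u S)).prod)
    (fun i hi => Finsupp.mem_support_iff.1 hi)
    (altSum_prod_eval_patch_eq_zero f.vars u Ψ)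
    (fun T hT => altSum_eq_zero_of_not_subset (fun S => by rw [patch_inter]) hT) ?_ ?_
  · refine ⟨f.vars.filter fun i => u i = 1, Finset.filter_subset _ _, ?_⟩
    simpa [patch_filter hu, List.prod_eq_zero_iff] using huΨ
  · intro S _ hS
    rw [eq_sub_iff_add_eq, ← hc]
    refine h _ ⟨patch_zero_or_one hu S, ?_⟩
    simpa [List.prod_eq_zero_iff] using hS

/-- One more disequality, `f ≠ A`, excludes the first value and reduces to the constant case. -/
theorem card_vars_le_of_two_values (f : LinPoly ℚ) (Ψ : List (LinPoly ℚ))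
    (hne : (sols Ψ).Nonempty) (A B : ℚ) (h : ∀ ρ ∈ sols Ψ, f.eval ρ = A ∨ f.eval ρ = B) :
    f.vars.card ≤ 2 * Ψ.length + 2 := by
  by_cases hA : ∀ ρ ∈ sols Ψ, f.eval ρ = A
  · have := card_vars_le_of_const f Ψ hne A hA
    omega
  · push Not at hA
    obtain ⟨u, hu, huA⟩ := hA
    refine card_vars_le_of_const f ((f - LinPoly.const A) :: Ψ) ⟨u, hu.1, ?_⟩ B ?_
    · simpa [LinPoly.eval_sub_const, sub_eq_zero, huA] using hu.2
    · rintro ρ ⟨hρ, hρΨ⟩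
      simp only [List.mem_cons, forall_eq_or_imp, LinPoly.eval_sub_const, sub_ne_zero] at hρΨ
      exact (h ρ ⟨hρ, hρΨ.2⟩).resolve_left hρΨ.1

end Solutions

/-! ### The invariant along a branch of the tree -/

section Game

/-- The disequality `d ≠ 0` follows from those in `Ψ`, or `d` agrees with a nonzero multiple of
some `f - A` on the solutions of `Ψ`. -/
def Tame (f : LinPoly ℚ) (Ψ : List (LinPoly ℚ)) (d : LinPoly ℚ) : Prop :=
  (∀ ρ ∈ sols Ψ, d.eval ρ ≠ 0) ∨
    ∃ γ A : ℚ, γ ≠ 0 ∧ ∀ ρ ∈ sols Ψ, d.eval ρ = γ * (f.eval ρ - A)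

theorem sols_cons_subset (g : LinPoly ℚ) (Ψ : List (LinPoly ℚ)) : sols (g :: Ψ) ⊆ sols Ψ :=
  fun _ h => ⟨h.1, fun g' hg' => h.2 g' (List.mem_cons_of_mem _ hg')⟩

theorem Tame.cons {f d : LinPoly ℚ} {Ψ : List (LinPoly ℚ)} (h : Tame f Ψ d) (g : LinPoly ℚ) :
    Tame f (g :: Ψ) d :=
  h.imp (fun h ρ hρ => h ρ (sols_cons_subset g Ψ hρ))
    fun ⟨γ, A, hγ, h⟩ => ⟨γ, A, hγ, fun ρ hρ => h ρ (sols_cons_subset g Ψ hρ)⟩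

theorem tame_cons_self (f g : LinPoly ℚ) (Ψ : List (LinPoly ℚ)) : Tame f (g :: Ψ) g :=
  Or.inl fun _ hρ => hρ.2 g List.mem_cons_self

/-- Passes tameness from a resolvent to one premise when the other resolved polynomial vanishes on
the solutions. If `β = 0`, the resolvent vanishes there too, which would make `f` constant; `hn`
excludes this. -/
theorem Tame.of_eval_eq_mul {f g h : LinPoly ℚ} {Ψ : List (LinPoly ℚ)} {β : ℚ}
    (hn : 2 * Ψ.length < f.vars.card) (hne : (sols Ψ).Nonempty) (ht : Tame f Ψ h)
    (he : ∀ ρ ∈ sols Ψ, h.eval ρ = β * g.eval ρ) : Tame f Ψ g := by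
  rcases ht with ht | ⟨γ, A, hγ, ht⟩
  · exact Or.inl fun ρ hρ h0 => ht ρ hρ (by rw [he ρ hρ, h0, mul_zero])
  · by_cases hβ : β = 0
    · refine absurd (card_vars_le_of_const f Ψ hne A fun ρ hρ => ?_) (not_le.2 hn)
      have h0 := ht ρ hρ
      rw [he ρ hρ, hβ, zero_mul] at h0
      exact sub_eq_zero.1 ((mul_eq_zero.1 h0.symm).resolve_left hγ)
    · refine Or.inr ⟨γ / β, A, div_ne_zero hγ hβ, fun ρ hρ => ?_⟩
      have h0 := ht ρ hρ
      rw [he ρ hρ] at h0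
      field_simp
      linarith

/-- `Ψ` cannot refute both disjuncts, so one is a nonzero multiple of `f - A` on the solutions; as
`xᵢ` is two-valued, `f` is too. -/
theorem card_vars_le_of_tame_booleanAxiom {f : LinPoly ℚ} {Ψ : List (LinPoly ℚ)}
    (hne : (sols Ψ).Nonempty) {i : ℕ} (h : ∀ d ∈ booleanAxiom ℚ i, Tame f Ψ d) :
    f.vars.card ≤ 2 * Ψ.length + 2 := by
  have h0 : Tame f Ψ (LinPoly.var ℚ i) := h _ (by simp [booleanAxiom])
  have h1 : Tame f Ψ (LinPoly.var ℚ i - LinPoly.const 1) := h _ (by simp [booleanAxiom])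
  rcases h0 with h0 | ⟨γ, A, hγ, h0⟩
  · rcases h1 with h1 | ⟨γ, A, hγ, h1⟩
    · obtain ⟨u, hu⟩ := hne
      have h0 := h0 u hu
      have h1 := h1 u hu
      rw [LinPoly.eval_sub_const, sub_ne_zero] at h1
      rw [LinPoly.eval_var] at h0 h1
      exact absurd (hu.1 i) (not_or.2 ⟨h0, h1⟩)
    · refine card_vars_le_of_two_values f Ψ hne (A - 1 / γ) A fun ρ hρ => ?_
      have h1 := h1 ρ hρ
      rw [LinPoly.eval_sub_const, LinPoly.eval_var] at h1
      rcases hρ.1 i with h | h <;> rw [h] at h1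
      · left
        field_simp
        linarith
      · right
        have : γ * (f.eval ρ - A) = 0 := by linarith
        exact sub_eq_zero.1 ((mul_eq_zero.1 this).resolve_left hγ)
  · refine card_vars_le_of_two_values f Ψ hne A (A + 1 / γ) fun ρ hρ => ?_
    have h0 := h0 ρ hρ
    rw [LinPoly.eval_var] at h0
    rcases hρ.1 i with h | h <;> rw [h] at h0
    · left
      exact sub_eq_zero.1 ((mul_eq_zero.1 h0.symm).resolve_left hγ)
    · right
      field_simp
      linarith

theorem two_le_clauseSize_booleanAxiom (i : ℕ) : 2 ≤ clauseSize (booleanAxiom ℚ i) := by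
  have h : polySize (LinPoly.var ℚ i) ≤ clauseSize (booleanAxiom ℚ i) :=
    Finset.single_le_sum (f := polySize) (fun _ _ => Nat.zero_le _) (by simp [booleanAxiom])
  refine le_trans ?_ h
  have : (LinPoly.var ℚ i).vars.card = 1 := by
    simp [LinPoly.var, LinPoly.vars]
  rw [polySize, this, coeffSize]
  omega

/-! ### Tree sizes and the exponential lower bound -/

variable {E : LinClause ℚ} (π : Derivation (∅ : Set (LinClause ℚ)) E)

/-- The size of the derivation tree of the `i`-th clause. -/
def Derivation.treeSize (i : Fin (π.length_pred + 1)) : ℕ :=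
  clauseSize (π.clause i) +
    ((π.premises i).attach.map fun j =>
      have := π.premises_lt i j.1 j.2
      Derivation.treeSize j.1).sum
termination_by i

theorem Derivation.treeSize_eq (i : Fin (π.length_pred + 1)) :
    π.treeSize i = clauseSize (π.clause i) + ((π.premises i).map π.treeSize).sum := by
  rw [Derivation.treeSize]
  rw [List.attach_map_val]

theorem sum_map_eq_sum_count {α : Type*} [Fintype α] [DecidableEq α] (l : List α)
    (g : α → ℕ) : (l.map g).sum = ∑ a, l.count a * g a := by
  induction l with
  | nil => simp
  | cons b l ih =>
    simp [List.count_cons, add_mul, Finset.sum_add_distrib, ih, add_comm]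

/-- Sum the recursion for `treeSize` over all positions: each position recurs at most once as a
premise and the last one never, so the other tree sizes cancel. -/
theorem Derivation.treeSize_last_le (h : π.TreeLike) :
    π.treeSize (Fin.last π.length_pred) ≤ π.size := by
  have h1 : ∑ i, π.treeSize i =
      π.size + ∑ j, (∑ i, (π.premises i).count j) * π.treeSize j := by
    rw [Finset.sum_congr rfl fun i _ => π.treeSize_eq i, Finset.sum_add_distrib, Derivation.size]
    simp_rw [sum_map_eq_sum_count, Finset.sum_mul]
    rw [Finset.sum_comm]
  have h2 : ∑ i, (π.premises i).count (Fin.last π.length_pred) = 0 :=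
    Finset.sum_eq_zero fun i _ => List.count_eq_zero.2 fun hi =>
      absurd (π.premises_lt i _ hi) (not_lt.2 (Fin.le_last i))
  rw [Fin.sum_univ_castSucc, Fin.sum_univ_castSucc (fun j => _ * π.treeSize j), h2] at h1
  have h3 : ∑ j : Fin π.length_pred,
      (∑ i, (π.premises i).count j.castSucc) * π.treeSize j.castSucc ≤
        ∑ j : Fin π.length_pred, π.treeSize j.castSucc :=
    Finset.sum_le_sum fun j _ => (Nat.mul_le_mul_right _ (h _)).trans_eq (one_mul _)
  omega

theorem Derivation.two_le_treeSize (i : Fin (π.length_pred + 1)) : 2 ≤ π.treeSize i := by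
  induction i using WellFoundedLT.induction with
  | ind i ih =>
    rw [π.treeSize_eq]
    rcases hp : π.premises i with _ | ⟨j, l⟩
    · have hinf := π.infer i
      rw [hp, List.map_nil] at hinf
      generalize π.clause i = C at hinf
      cases hinf with
      | hyp C hC => exact absurd hC (Set.notMem_empty C)
      | boolean i => exact le_add_right (two_le_clauseSize_booleanAxiom i)
    · have := ih j (π.premises_lt i j (by simp [hp]))
      rw [List.map_cons, List.sum_cons]
      omega

/-- The tree size of a clause at least doubles for each disequality that has to be added before
`f` takes at most two values. -/
theorem Derivation.two_pow_le_treeSize (f : LinPoly ℚ) (i : Fin (π.length_pred + 1)) :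
    ∀ Ψ : List (LinPoly ℚ), (sols Ψ).Nonempty → (∀ d ∈ π.clause i, Tame f Ψ d) →
      2 ^ ((f.vars.card - 1) / 2 + 1) ≤ π.treeSize i * 2 ^ Ψ.length := by
  induction i using WellFoundedLT.induction with
  | ind i ih =>
    intro Ψ hne ht
    by_cases hn : f.vars.card ≤ 2 * Ψ.length + 2
    -- `Ψ` is already long enough; the extra factor 2 is the minimal tree size, forced by a boolean
    -- axiom at a leaf.
    · calc 2 ^ ((f.vars.card - 1) / 2 + 1) ≤ 2 ^ (Ψ.length + 1) :=
            Nat.pow_le_pow_right two_pos (by omega)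
        _ = 2 * 2 ^ Ψ.length := pow_succ' _ _
        _ ≤ π.treeSize i * 2 ^ Ψ.length := Nat.mul_le_mul_right _ (π.two_le_treeSize i)
    have hle : ∀ j ∈ π.premises i, π.treeSize j ≤ π.treeSize i := by
      intro j hj
      rw [π.treeSize_eq i]
      exact le_add_left (List.le_sum_of_mem (List.mem_map_of_mem hj))
    have step : ∀ j ∈ π.premises i, (∀ d ∈ π.clause j, Tame f Ψ d) →
        2 ^ ((f.vars.card - 1) / 2 + 1) ≤ π.treeSize i * 2 ^ Ψ.length := fun j hj h =>
      (ih j (π.premises_lt i j hj) Ψ hne h).trans (Nat.mul_le_mul_right _ (hle j hj))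
    have hinf := π.infer i
    generalize hPs : (π.premises i).map π.clause = Ps at hinf
    generalize hC : π.clause i = C at hinf ht
    cases hinf with
    | hyp C hC => exact absurd hC (Set.notMem_empty C)
    | boolean k => exact absurd (card_vars_le_of_tame_booleanAxiom hne ht) hn
    | simplification C a ha =>
      obtain ⟨j, l, hp, hj, -⟩ := List.map_eq_cons_iff.1 hPs
      refine step j (by simp [hp]) ?_
      rw [hj, Finset.forall_mem_insert]
      exact ⟨Or.inl fun ρ _ => by rwa [LinPoly.eval_const], ht⟩
    | weakening C g =>
      obtain ⟨j, l, hp, hj, -⟩ := List.map_eq_cons_iff.1 hPs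
      refine step j (by simp [hp]) ?_
      rw [hj]
      exact fun d hd => ht d (Finset.mem_insert_of_mem hd)
    | resolution C D g h α β =>
      obtain ⟨j, l, hp, hj, hl⟩ := List.map_eq_cons_iff.1 hPs
      obtain ⟨k, l', rfl, hk, hl'⟩ := List.map_eq_cons_iff.1 hl
      obtain rfl := List.map_eq_nil_iff.1 hl'
      rw [Finset.forall_mem_insert] at ht
      obtain ⟨hgh, ht⟩ := ht
      have htC : ∀ d ∈ C, Tame f Ψ d := fun d hd => ht d (Finset.mem_union_left _ hd)
      have htD : ∀ d ∈ D, Tame f Ψ d := fun d hd => ht d (Finset.mem_union_right _ hd)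
      have hmj : j ∈ π.premises i := by simp [hp]
      have hmk : k ∈ π.premises i := by simp [hp]
      by_cases hg : ∀ ρ ∈ sols Ψ, g.eval ρ = 0
      · refine step k hmk ?_
        rw [hk, Finset.forall_mem_insert]
        exact ⟨hgh.of_eval_eq_mul (β := β) (by omega) hne fun ρ hρ => by
          rw [LinPoly.eval_add, LinPoly.eval_smul, LinPoly.eval_smul, hg ρ hρ]; ring, htD⟩
      by_cases hh : ∀ ρ ∈ sols Ψ, h.eval ρ = 0
      · refine step j hmj ?_
        rw [hj, Finset.forall_mem_insert]
        exact ⟨hgh.of_eval_eq_mul (β := α) (by omega) hne fun ρ hρ => by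
          rw [LinPoly.eval_add, LinPoly.eval_smul, LinPoly.eval_smul, hh ρ hρ]; ring, htC⟩
      -- Neither polynomial vanishes identically, so `g ≠ 0` and `h ≠ 0` are each consistent with
      -- `Ψ`; both subtrees count, and the doubling pays for the longer list.
      push Not at hg hh
      obtain ⟨u, hu, hgu⟩ := hg
      obtain ⟨v, hv, hhv⟩ := hh
      have h1 := ih j (π.premises_lt i j hmj) (g :: Ψ)
        ⟨u, hu.1, List.forall_mem_cons.2 ⟨hgu, hu.2⟩⟩ (by
          rw [hj, Finset.forall_mem_insert]
          exact ⟨tame_cons_self f g Ψ, fun d hd => (htC d hd).cons g⟩)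
      have h2 := ih k (π.premises_lt i k hmk) (h :: Ψ)
        ⟨v, hv.1, List.forall_mem_cons.2 ⟨hhv, hv.2⟩⟩ (by
          rw [hk, Finset.forall_mem_insert]
          exact ⟨tame_cons_self f h Ψ, fun d hd => (htD d hd).cons h⟩)
      have h3 : π.treeSize j + π.treeSize k ≤ π.treeSize i := by
        rw [π.treeSize_eq i, hp]
        simp
      rw [List.length_cons, pow_succ 2 Ψ.length] at h1 h2
      nlinarith [Nat.mul_le_mul_right (2 ^ Ψ.length) h3]

end Game

end ResLin

theorem mainTheorem4 :
    ∃ c : ℝ, 0 < c ∧ ∀ (n : ℕ) (f : ResLin.LinPoly ℚ), f.vars.card = n →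
      ∀ π : ResLin.Derivation (∅ : Set (ResLin.LinClause ℚ)) (ResLin.imageAxiom f),
        π.TreeLike → (2 : ℝ) ^ (c * Real.sqrt n) ≤ (π.size : ℝ) := by
  refine ⟨1 / 2, by norm_num, fun n f hn π hπ => ?_⟩
  have h := π.two_pow_le_treeSize f (Fin.last π.length_pred) [] ⟨0, by simp [ResLin.sols]⟩ <| by
    intro d hd
    rw [π.clause_last, ResLin.imageAxiom, Finset.mem_image] at hd
    obtain ⟨A, _, rfl⟩ := hd
    exact Or.inr ⟨1, A, one_ne_zero, fun ρ _ => by rw [ResLin.LinPoly.eval_sub_const, one_mul]⟩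
  rw [List.length_nil, pow_zero, mul_one, hn] at h
  have h' : ((2 : ℝ) ^ ((n - 1) / 2 + 1)) ≤ π.size := by
    exact_mod_cast h.trans (π.treeSize_last_le hπ)
  refine le_trans ?_ h'
  rw [← Real.rpow_natCast]
  refine Real.rpow_le_rpow_of_exponent_le (by norm_num) ?_
  -- The exponent is already at least `n / 2`; only here is it weakened to `√n / 2`.
  have h1 : Real.sqrt n ≤ n := by
    rcases Nat.eq_zero_or_pos n with rfl | hn
    · simp
    · have : (1 : ℝ) ≤ n := by exact_mod_cast hn
      exact Real.sqrt_le_iff.2 ⟨by linarith, by nlinarith⟩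
  have h2 : (n : ℝ) ≤ 2 * (((n - 1) / 2 + 1 : ℕ) : ℝ) := by
    exact_mod_cast (by omega : n ≤ 2 * ((n - 1) / 2 + 1))
  linarith
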